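/- Let $n\ge 2$ be a natural number. Consider Boolean algebras $(A,+,\cdot,-,0,1)$ with additional unary operations $c_i$ ($i<n$) and constants $d_{ij}$ ($i,j<n$). Such an algebra is in $NCA_n$ (non-commutative cylindric algebras) if for all $x,y\in A$ and $i,j,k<n$: $c_i0=0$; $x\le c_ix$; $c_i(x\cdot c_iy)=c_ix\cdot c_iy$; $d_{ii}=1$; $d_{ij}=c_k(d_{ik}\cdot d_{kj})$ if $k\notin\{i,j\}$; and $c_i(d_{ij}\cdot x)\cdot c_i(d_{ij}\cdot -x)=0$ if $i\ne j$. It is in $WCA_n$ (weakened cylindric algebras) if it satisfies the same axioms with the fifth one replaced by: $d_{ij}=d_{ji}$ for all $i,j<n$, and $d_{ik}\cdot d_{kj}\le d_{ij}=c_kd_{ij}$ if $k\notin\{i,j\}$. Let $K\in\{NCA_n,WCA_n\}$, let $m$ be a natural number, and let $\mathfrak{Fr}_mK$ be the free algebra of $K$ on $m$ generators, i.e. the algebra of terms in the variables $x_0,\dots,x_{m-1}$ modulo the equations valid in $K$. Then: 1. In $\mathfrak{Fr}_mK$ there is no atom below $t=\prod\{-d_{ij}: i<j<n\}$. 2. Hence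 $\mathfrak{Fr}_mK$ is not atomic, i.e. some nonzero element has no atom below it. 3. Equivalently to 2, the corresponding logic with $m$ atomic formulas has the weak Gödel incompleteness property: call terms in $x_0,\dots,x_{m-1}$ formulas, and say that a finite set $T$ of formulas proves $\psi$ if $\prod T\le\psi$ is valid in $K$; then there is a consistent formula $\varphi$ such that no finite, consistent and complete set $T$ of formulas proves $\varphi$. (Here $T$ is consistent if it does not prove $0$, and complete if for every $\psi$ it proves $\psi$ or $-\psi$.) -/

import Mathlib

namespace CylAlg

universe u

/-- The non-Boolean operations of the type `cyl_n`: the cylindrifications `c_i` and the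
diagonal constants `d_ij`. The Boolean operations, together with the Boolean axioms, are those
of Mathlib's `BooleanAlgebra`. -/
class CylOps (n : ℕ) (A : Type u) where
  /-- the cylindrification `c_i` -/
  c : Fin n → A → A
  /-- the diagonal constant `d_ij` -/
  d : Fin n → Fin n → A

open CylOps

/-- Non-commutative cylindric algebras of dimension `n`: all axioms of cylindric algebras, except
the commutativity of the cylindrifications. -/
structure IsNCA (n : ℕ) (A : Type u) [BooleanAlgebra A] [CylOps n A] : Prop where
  c1 : ∀ i : Fin n, c i (⊥ : A) = ⊥
  c2 : ∀ (i : Fin n) (x : A), x ≤ c i x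
  c3 : ∀ (i : Fin n) (x y : A), c i (x ⊓ c i y) = c i x ⊓ c i y
  c5 : ∀ i : Fin n, (d i i : A) = ⊤
  c6 : ∀ i j k : Fin n, k ≠ i → k ≠ j → (d i j : A) = c k (d i k ⊓ d k j)
  c7 : ∀ (i j : Fin n) (x : A), i ≠ j → c i (d i j ⊓ x) ⊓ c i (d i j ⊓ xᶜ) = ⊥

/-- Weakened cylindric algebras of dimension `n`: as non-commutative cylindric algebras, with the
axiom `c6` replaced by three weaker ones. -/
structure IsWCA (n : ℕ) (A : Type u) [BooleanAlgebra A] [CylOps n A] : Prop where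
  c1 : ∀ i : Fin n, c i (⊥ : A) = ⊥
  c2 : ∀ (i : Fin n) (x : A), x ≤ c i x
  c3 : ∀ (i : Fin n) (x y : A), c i (x ⊓ c i y) = c i x ⊓ c i y
  c5 : ∀ i : Fin n, (d i i : A) = ⊤
  wc6_symm : ∀ i j : Fin n, (d i j : A) = d j i
  wc6_trans : ∀ i j k : Fin n, k ≠ i → k ≠ j → (d i k ⊓ d k j : A) ≤ d i j
  wc6_cyl : ∀ i j k : Fin n, k ≠ i → k ≠ j → (d i j : A) = c k (d i j)
  c7 : ∀ (i j : Fin n) (x : A), i ≠ j → c i (d i j ⊓ x) ⊓ c i (d i j ⊓ xᶜ) = ⊥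

/-- The terms of type `cyl_n` in the variables `x_0, …, x_{m-1}`. -/
inductive Term (n m : ℕ) : Type where
  | var : Fin m → Term n m
  | zero : Term n m
  | one : Term n m
  | diag : Fin n → Fin n → Term n m
  | neg : Term n m → Term n m
  | cyl : Fin n → Term n m → Term n m
  | mul : Term n m → Term n m → Term n m
  | add : Term n m → Term n m → Term n m

/-- The value of a term in an algebra under an evaluation of the variables. -/
def Term.eval {n m : ℕ} {A : Type u} [BooleanAlgebra A] [CylOps n A] (e : Fin m → A) :
    Term n m → A
  | .var x => e x
  | .zero => ⊥
  | .one => ⊤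
  | .diag i j => d i j
  | .neg s => (s.eval e)ᶜ
  | .cyl i s => c i (s.eval e)
  | .mul s t => s.eval e ⊓ t.eval e
  | .add s t => s.eval e ⊔ t.eval e

/-- Classes of algebras of type `cyl_n` that satisfy the Boolean axioms. -/
abbrev AlgClass (n : ℕ) := ∀ (A : Type) [BooleanAlgebra A] [CylOps n A], Prop

/-- `s` and `t` are identified when the equation `s = t` holds in all members of `K`. -/
def freeSetoid {n : ℕ} (K : AlgClass n) (m : ℕ) : Setoid (Term n m) where
  r s t := ∀ (A : Type) [BooleanAlgebra A] [CylOps n A], K A →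
    ∀ e : Fin m → A, s.eval e = t.eval e
  iseqv :=
    { refl := fun _ _ _ _ _ _ => rfl
      symm := fun h A _ _ hA e => (h A hA e).symm
      trans := fun h₁ h₂ A _ _ hA e => (h₁ A hA e).trans (h₂ A hA e) }

/-- The `m`-generated free algebra of the class `K`: the term algebra modulo the equations that
hold in `K`. -/
def Fr {n : ℕ} (K : AlgClass n) (m : ℕ) : Type := Quotient (freeSetoid K m)

namespace Fr

variable {n : ℕ} {K : AlgClass n} {m : ℕ}

/-- The element of the free algebra given by a term. -/
def mk (K : AlgClass n) (s : Term n m) : Fr K m := Quotient.mk (freeSetoid K m) s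

theorem mk_eq_mk {s t : Term n m} : mk K s = mk K t ↔
    ∀ (A : Type) [BooleanAlgebra A] [CylOps n A], K A →
      ∀ e : Fin m → A, s.eval e = t.eval e :=
  Quotient.eq (r := freeSetoid K m)

/-- The meet, computed on terms. -/
def mul : Fr K m → Fr K m → Fr K m :=
  Quotient.map₂ Term.mul fun _ _ h₁ _ _ h₂ A i₁ i₂ hA e =>
    congrArg₂ (fun a b : A => a ⊓ b) (@h₁ A i₁ i₂ hA e) (@h₂ A i₁ i₂ hA e)

/-- The join, computed on terms. -/
def add : Fr K m → Fr K m → Fr K m :=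
  Quotient.map₂ Term.add fun _ _ h₁ _ _ h₂ A i₁ i₂ hA e =>
    congrArg₂ (fun a b : A => a ⊔ b) (@h₁ A i₁ i₂ hA e) (@h₂ A i₁ i₂ hA e)

/-- The complement, computed on terms. -/
def neg : Fr K m → Fr K m :=
  Quotient.map Term.neg fun _ _ h A i₁ i₂ hA e =>
    congrArg (fun a : A => aᶜ) (@h A i₁ i₂ hA e)

/-- The Boolean operations of the free algebra, computed on terms, with the order
`x ≤ y ↔ x · y = x`. -/
instance : BooleanAlgebra (Fr K m) where
  le x y := mul x y = x
  inf := mul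
  sup := add
  compl := neg
  bot := mk K Term.zero
  top := mk K Term.one
  le_refl := by
    rintro ⟨x⟩
    exact mk_eq_mk.2 fun A _ _ hA e => by simp [Term.eval]
  le_trans := by
    rintro ⟨x⟩ ⟨y⟩ ⟨z⟩ hxy hyz
    refine mk_eq_mk.2 fun A _ _ hA e => ?_
    have h₁ := mk_eq_mk.1 hxy A hA e
    have h₂ := mk_eq_mk.1 hyz A hA e
    simp only [Term.eval, inf_eq_left] at h₁ h₂ ⊢
    exact h₁.trans h₂
  le_antisymm := by
    rintro ⟨x⟩ ⟨y⟩ hxy hyx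
    refine mk_eq_mk.2 fun A _ _ hA e => ?_
    have h₁ := mk_eq_mk.1 hxy A hA e
    have h₂ := mk_eq_mk.1 hyx A hA e
    simp only [Term.eval, inf_eq_left] at h₁ h₂
    exact le_antisymm h₁ h₂
  le_sup_left := by
    rintro ⟨x⟩ ⟨y⟩
    exact mk_eq_mk.2 fun A _ _ hA e => by simp [Term.eval]
  le_sup_right := by
    rintro ⟨x⟩ ⟨y⟩
    exact mk_eq_mk.2 fun A _ _ hA e => by simp [Term.eval]
  sup_le := by
    rintro ⟨x⟩ ⟨y⟩ ⟨z⟩ hxz hyz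
    refine mk_eq_mk.2 fun A _ _ hA e => ?_
    have h₁ := mk_eq_mk.1 hxz A hA e
    have h₂ := mk_eq_mk.1 hyz A hA e
    simp only [Term.eval, inf_eq_left] at h₁ h₂ ⊢
    exact sup_le h₁ h₂
  inf_le_left := by
    rintro ⟨x⟩ ⟨y⟩
    exact mk_eq_mk.2 fun A _ _ hA e => by simp [Term.eval]
  inf_le_right := by
    rintro ⟨x⟩ ⟨y⟩
    exact mk_eq_mk.2 fun A _ _ hA e => by simp [Term.eval]
  le_inf := by
    rintro ⟨x⟩ ⟨y⟩ ⟨z⟩ hxy hxz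
    refine mk_eq_mk.2 fun A _ _ hA e => ?_
    have h₁ := mk_eq_mk.1 hxy A hA e
    have h₂ := mk_eq_mk.1 hxz A hA e
    simp only [Term.eval, inf_eq_left] at h₁ h₂ ⊢
    exact le_inf h₁ h₂
  le_sup_inf := by
    rintro ⟨x⟩ ⟨y⟩ ⟨z⟩
    refine mk_eq_mk.2 fun A _ _ hA e => ?_
    simp only [Term.eval, inf_eq_left]
    exact le_sup_inf
  inf_compl_le_bot := by
    rintro ⟨x⟩
    exact mk_eq_mk.2 fun A _ _ hA e => by simp [Term.eval]
  top_le_sup_compl := by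
    rintro ⟨x⟩
    exact mk_eq_mk.2 fun A _ _ hA e => by simp [Term.eval]
  le_top := by
    rintro ⟨x⟩
    exact mk_eq_mk.2 fun A _ _ hA e => by simp [Term.eval]
  bot_le := by
    rintro ⟨x⟩
    exact mk_eq_mk.2 fun A _ _ hA e => by simp [Term.eval]

/-- The cylindrifications and diagonal constants of the free algebra, computed on terms. -/
instance : CylOps n (Fr K m) where
  c i := Quotient.map (Term.cyl i) fun _ _ h A i₁ i₂ hA e =>
    congrArg (fun a : A => CylOps.c i a) (@h A i₁ i₂ hA e)
  d i j := mk K (Term.diag i j)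

end Fr

/-- The element `∏_{i < j < n} -d_ij`. -/
def offDiag (n : ℕ) (A : Type u) [BooleanAlgebra A] [CylOps n A] : A :=
  (Finset.univ.filter fun p : Fin n × Fin n => p.1 < p.2).inf fun p => (d p.1 p.2)ᶜ

/-- In the logic of `K`, whose formulas are the terms of type `cyl_n` (`c_i` is the quantifier
`∃ v_i`, `d_ij` is the formula `v_i = v_j`, the variables are the atomic formulas), the formula `ψ`
is a consequence of the finite set `T` of formulas: its value is always above the meet of the values
of the members of `T`. -/
def Proves {n m : ℕ} (K : AlgClass n) (T : Finset (Term n m)) (ψ : Term n m) : Prop :=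
  ∀ (A : Type) [BooleanAlgebra A] [CylOps n A], K A →
    ∀ e : Fin m → A, T.inf (fun φ => φ.eval e) ≤ ψ.eval e

/-- `T` does not prove falsity. -/
def Consistent {n m : ℕ} (K : AlgClass n) (T : Finset (Term n m)) : Prop :=
  ¬ Proves K T Term.zero

/-- `T` decides every formula. -/
def Complete {n m : ℕ} (K : AlgClass n) (T : Finset (Term n m)) : Prop :=
  ∀ ψ : Term n m, Proves K T ψ ∨ Proves K T ψ.neg

/-- The weak Gödel incompleteness property of the logic of `K` with `m` atomic formulas: some
consistent formula belongs to no finitely axiomatized, consistent and complete theory. -/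
def WeakGoedelIncompleteness {n : ℕ} (K : AlgClass n) (m : ℕ) : Prop :=
  ∃ φ : Term n m, Consistent K {φ} ∧
    ∀ T : Finset (Term n m), Consistent K T → Proves K T φ → ¬ Complete K T

end CylAlg

namespace CylAlg

open CylOps

universe u

/-! Both classes are complete for frames. Passing from an algebra to its ultrafilters shows that a
term is nonzero in the free algebra iff it holds at some point of a frame, which for `IsNCA` must
also be replete (`mk_ne_bot_iff`). It therefore suffices to split each term `s` that holds at a
point `w` off all diagonals: to find `b` such that `s · b` and `s · -b` are both satisfiable
(`exists_split`).

Since cylindrifications need not commute, a frame can be unravelled from `w` into a tree of paths,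
where an `i`-class is just a node with its `i`-children. A term of depth `h`, evaluated at the root,
cannot see below level `h` (`sat_unravel`), so below level `2 * h` the tree may be continued at
will. It is continued by maps `Fin n → Fin n`, whose kernels prescribe the diagonals. If all maps
are allowed, transposing two values again and again yields arbitrarily long walks alternating
between points off all diagonals and points of `D i j` (`sat_walk`). If only non-injective maps are
allowed, every point off the diagonals lies at level at most `2 * h`, and such walks have bounded
length (`walk_le`). Repleteness survives, because it asks only for points on diagonals. The term `b`
says that a walk longer than this bound starts within reach.

For the logic, the conjunction of a finite, consistent and complete theory is an atom
(`isAtom_of_complete`), so no such theory proves `offTerm`. -/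

/-! ### Frames and their complex algebras -/

/-- Relational structures whose complex algebras are weakened cylindric algebras. -/
structure Frame (n : ℕ) (W : Type u) where
  /-- the accessibility relation of the `i`-th cylindrification -/
  r : Fin n → W → W → Prop
  /-- the set of points of the `ij`-diagonal -/
  D : Fin n → Fin n → W → Prop
  equiv : ∀ i, Equivalence (r i)
  D_refl : ∀ i x, D i i x
  D_symm : ∀ i j x, D i j x → D j i x
  D_trans : ∀ i j k x, D i k x → D k j x → D i j x
  D_cyl : ∀ i j k x y, k ≠ i → k ≠ j → r k x y → D i j x → D i j y
  D_uniq : ∀ i j x y, i ≠ j → r i x y → D i j x → D i j y → x = y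

namespace Frame

variable {n m : ℕ} {W : Type u}

/-- Every class of `r i` meets every diagonal `D i j`. -/
def Replete (F : Frame n W) : Prop :=
  ∀ i j, i ≠ j → ∀ x, ∃ y, F.r i x y ∧ F.D i j y

/-- The operations of the complex algebra of a frame. -/
abbrev cylOps (F : Frame n W) : CylOps n (Set W) where
  c i S := {x | ∃ y, F.r i x y ∧ y ∈ S}
  d i j := {x | F.D i j x}

theorem isWCA (F : Frame n W) : @IsWCA n (Set W) _ F.cylOps := by
  let _ := F.cylOps
  refine ⟨fun i => ?_, fun i S x hx => ⟨x, (F.equiv i).refl x, hx⟩, fun i S T => ?_,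
    fun i => ?_, fun i j => ?_, fun i j k _ _ x hx => F.D_trans i j k x hx.1 hx.2,
    fun i j k hi hj => ?_, fun i j S hij => ?_⟩
  · ext x
    simp [CylOps.c]
  · ext x
    constructor
    · rintro ⟨y, hxy, hy, z, hyz, hz⟩
      exact ⟨⟨y, hxy, hy⟩, z, (F.equiv i).trans hxy hyz, hz⟩
    · rintro ⟨⟨y, hxy, hy⟩, z, hxz, hz⟩
      exact ⟨y, hxy, hy, z, (F.equiv i).trans ((F.equiv i).symm hxy) hxz, hz⟩
  · ext x
    simp [CylOps.d, F.D_refl]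
  · ext x
    exact ⟨F.D_symm i j x, F.D_symm j i x⟩
  · ext x
    exact ⟨fun h => ⟨x, (F.equiv k).refl x, h⟩, fun ⟨y, hxy, hy⟩ =>
      F.D_cyl i j k y x hi hj ((F.equiv k).symm hxy) hy⟩
  · refine Set.eq_empty_of_forall_notMem ?_
    rintro x ⟨⟨y, hxy, hy, hyS⟩, z, hxz, hz, hzS⟩
    have := F.D_uniq i j y z hij ((F.equiv i).trans ((F.equiv i).symm hxy) hxz) hy hz
    exact hzS (this ▸ hyS)

/-- Repleteness gives the existence half of `c6`: from a point of `D i j`, move in direction `k`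
onto `D k i`. The point stays on `D i j`, as `k` is neither `i` nor `j`, and so it also lies on `D k
j`. -/
theorem Replete.isNCA {F : Frame n W} (hF : F.Replete) : @IsNCA n (Set W) _ F.cylOps := by
  let _ := F.cylOps
  have h := F.isWCA
  refine ⟨h.c1, h.c2, h.c3, h.c5, fun i j k hi hj => ?_, h.c7⟩
  ext x
  constructor
  · intro hx
    obtain ⟨y, hxy, hy⟩ := hF k i hi x
    have hij : F.D i j y := F.D_cyl i j k x y hi hj hxy hx
    exact ⟨y, hxy, F.D_symm _ _ _ hy, F.D_trans _ _ _ _ hy hij⟩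
  · rintro ⟨y, hxy, hik, hkj⟩
    exact F.D_cyl i j k y x hi hj ((F.equiv k).symm hxy) (F.D_trans _ _ _ _ hik hkj)

/-- Truth of a term at a point of a frame. -/
def Sat (F : Frame n W) (e : Fin m → Set W) : Term n m → W → Prop
  | .var v, x => x ∈ e v
  | .zero, _ => False
  | .one, _ => True
  | .diag i j, x => F.D i j x
  | .neg s, x => ¬ F.Sat e s x
  | .cyl i s, x => ∃ y, F.r i x y ∧ F.Sat e s y
  | .mul s t, x => F.Sat e s x ∧ F.Sat e t x
  | .add s t, x => F.Sat e s x ∨ F.Sat e t x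

theorem mem_eval (F : Frame n W) (e : Fin m → Set W) (s : Term n m) (x : W) :
    x ∈ (@Term.eval n m (Set W) _ F.cylOps e s) ↔ F.Sat e s x := by
  let _ := F.cylOps
  induction s generalizing x with
  | var v => rfl
  | zero => rfl
  | one => exact Iff.rfl
  | diag i j => rfl
  | neg s ih => exact not_congr (ih x)
  | cyl i s ih => exact exists_congr fun y => and_congr_right fun _ => ih y
  | mul s t ihs iht => exact and_congr (ihs x) (iht x)
  | add s t ihs iht => exact or_congr (ihs x) (iht x)

end Frame

/-! ### Consequences of the axioms -/

section Algebra

variable {n : ℕ} {A : Type u} [BooleanAlgebra A] [CylOps n A]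

theorem IsNCA.isWCA (h : IsNCA n A) : IsWCA n A := by
  have htop (k : Fin n) : c k (⊤ : A) = ⊤ := top_le_iff.1 (h.c2 k ⊤)
  have hidem (k : Fin n) (x : A) : c k (c k x) = c k x := by
    simpa [htop] using h.c3 k ⊤ x
  have hle (i j : Fin n) : (d i j : A) ≤ d j i := by
    by_cases hij : i = j
    · rw [hij]
    -- By `c6`, `c i (d j i ⊓ d i j) = d j j = ⊤`, so `c7` forces `c i (d i j ⊓ (d j i)ᶜ)` to
    -- vanish.
    have h₁ := h.c7 i j (d j i) hij
    rw [inf_comm (d i j), ← h.c6 j j i hij hij, h.c5, top_inf_eq] at h₁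
    have h₂ := h.c2 i (d i j ⊓ (d j i)ᶜ : A)
    rw [h₁, le_bot_iff] at h₂
    exact disjoint_compl_right_iff.1 (disjoint_iff.2 h₂)
  refine ⟨h.c1, h.c2, h.c3, h.c5, fun i j => (hle i j).antisymm (hle j i),
    fun i j k hi hj => ?_, fun i j k hi hj => ?_, h.c7⟩
  · rw [h.c6 i j k hi hj]
    exact h.c2 _ _
  · rw [h.c6 i j k hi hj, hidem]

theorem IsNCA.c_d_eq_top (h : IsNCA n A) {i j : Fin n} (hij : i ≠ j) : c i (d i j : A) = ⊤ := by
  have h₁ := h.c6 j j i hij hij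
  rwa [h.isWCA.wc6_symm j i, inf_idem, h.c5, eq_comm] at h₁

namespace IsWCA

theorem c_top (h : IsWCA n A) (k : Fin n) : c k (⊤ : A) = ⊤ := top_le_iff.1 (h.c2 k ⊤)

theorem c_compl (h : IsWCA n A) (k : Fin n) (x : A) : c k (c k x)ᶜ = (c k x)ᶜ := by
  refine le_antisymm ?_ (h.c2 _ _)
  have := h.c3 k (c k x)ᶜ x
  rw [compl_inf_eq_bot, h.c1] at this
  exact le_compl_iff_disjoint_right.2 (disjoint_iff.2 this.symm)

end IsWCA

end Algebra

/-! ### Ultrafilters and the canonical frame -/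

/-- Ultrafilters of a Boolean algebra. -/
structure Ultra (A : Type u) [BooleanAlgebra A] where
  /-- the members of the ultrafilter -/
  mem : A → Prop
  mem_inf : ∀ x y, mem (x ⊓ y) ↔ mem x ∧ mem y
  mem_compl : ∀ x, mem xᶜ ↔ ¬ mem x

namespace Ultra

variable {A : Type u} [BooleanAlgebra A]

theorem ext {U V : Ultra A} (h : ∀ x, U.mem x → V.mem x) : U = V := by
  have : U.mem = V.mem := funext fun x => propext ⟨h x, fun hx => by
    by_contra hn
    exact (V.mem_compl x).1 (h _ ((U.mem_compl x).2 hn)) hx⟩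
  cases U; cases V; cases this; rfl

theorem mono (U : Ultra A) {x y : A} (hxy : x ≤ y) (hx : U.mem x) : U.mem y := by
  rw [← inf_eq_left.2 hxy, U.mem_inf] at hx
  exact hx.2

theorem not_bot (U : Ultra A) : ¬ U.mem ⊥ := fun h => by
  have h' := U.mono bot_le h (y := (⊥ : A)ᶜ)
  exact (U.mem_compl _).1 h' h

theorem mem_top (U : Ultra A) : U.mem ⊤ := by
  rw [← compl_bot, U.mem_compl]
  exact U.not_bot

theorem mem_sup (U : Ultra A) (x y : A) : U.mem (x ⊔ y) ↔ U.mem x ∨ U.mem y := by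
  rw [← not_iff_not, ← U.mem_compl, compl_sup, U.mem_inf, U.mem_compl, U.mem_compl, not_or]

theorem exists_of_filter (p : A → Prop) (htop : p ⊤) (hinf : ∀ x y, p x → p y → p (x ⊓ y))
    (hup : ∀ x y, x ≤ y → p x → p y) (hbot : ¬ p ⊥) : ∃ U : Ultra A, ∀ x, p x → U.mem x := by
  have hp : Order.IsPFilter {x | p x} := Order.IsPFilter.of_def ⟨⊤, htop⟩
    (fun x hx y hy => ⟨x ⊓ y, hinf x y hx hy, inf_le_left, inf_le_right⟩)
    (fun hxy hx => hup _ _ hxy hx)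
  obtain ⟨J, hJ, -, hdis⟩ := DistribLattice.prime_ideal_of_disjoint_filter_ideal
    (F := hp.toPFilter) (I := Order.Ideal.principal (⊥ : A)) (by
      refine Set.disjoint_left.2 fun x hx hx' => hbot ?_
      have : x = ⊥ := le_bot_iff.1 hx'
      exact this ▸ hx)
  refine ⟨⟨fun x => x ∉ J, fun x y => ?_, fun x => ?_⟩, fun x hx =>
    Set.disjoint_left.1 hdis hx⟩
  · constructor
    · exact fun h => ⟨fun hx => h (J.lower inf_le_left hx), fun hy => h (J.lower inf_le_right hy)⟩
    · rintro ⟨hx, hy⟩ h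
      exact (hJ.mem_or_mem h).elim hx hy
  · constructor
    · exact fun h hx => h (hJ.mem_or_compl_mem.resolve_left hx)
    · intro hx h
      refine hJ.toIsProper.ne_univ (Set.eq_univ_of_forall fun y => ?_)
      have := J.sup_mem (not_not.1 hx) h
      rw [sup_compl_eq_top] at this
      exact J.lower le_top this

end Ultra

section Canonical

variable {n m : ℕ} {A : Type u} [BooleanAlgebra A] [CylOps n A]

/-- The accessibility relation of the canonical frame. -/
def canonicalRel (i : Fin n) (U V : Ultra A) : Prop := ∀ x : A, U.mem (c i x) ↔ V.mem (c i x)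

/-- `V` extends the filter generated by `y` and the elements `c i u` of `U`. This filter is proper:
if `y ⊓ c i u = ⊥`, then `c3` gives `c i y ⊓ c i u = ⊥`, although both factors belong to `U`. -/
theorem IsWCA.exists_canonicalRel (h : IsWCA n A) {i : Fin n} {U : Ultra A} {y : A}
    (hy : U.mem (c i y)) : ∃ V, canonicalRel i U V ∧ V.mem y := by
  obtain ⟨V, hV⟩ := Ultra.exists_of_filter
    (fun z => ∃ u : A, U.mem (c i u) ∧ c i u ⊓ y ≤ z) ⟨⊤, by
      rw [h.c_top]; exact U.mem_top, le_top⟩ (by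
      rintro z w ⟨u, hu, huz⟩ ⟨v, hv, hvw⟩
      refine ⟨u ⊓ c i v, ?_, ?_⟩
      · rw [h.c3, U.mem_inf]
        exact ⟨hu, hv⟩
      · rw [h.c3]
        exact le_inf ((inf_le_inf_right _ inf_le_left).trans huz)
          ((inf_le_inf_right _ inf_le_right).trans hvw))
    (fun z w hzw ⟨u, hu, huz⟩ => ⟨u, hu, huz.trans hzw⟩) (by
      rintro ⟨u, hu, hbot⟩
      have h₁ := h.c3 i y u
      rw [inf_comm, le_bot_iff.1 hbot, h.c1] at h₁
      refine U.not_bot ?_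
      rw [h₁, U.mem_inf]
      exact ⟨hy, hu⟩)
  refine ⟨V, fun x => ⟨fun hx => hV _ ⟨x, hx, inf_le_left⟩, fun hx => ?_⟩,
    hV _ ⟨⊤, by rw [h.c_top]; exact U.mem_top, inf_le_right⟩⟩
  by_contra hn
  refine (V.mem_compl (c i x)).1 (hV _ ⟨(c i x)ᶜ, ?_, ?_⟩) hx
  · rwa [h.c_compl, U.mem_compl]
  · rw [h.c_compl]
    exact inf_le_left

/-- The frame of the ultrafilters of a weakened cylindric algebra. -/
def IsWCA.canonical (h : IsWCA n A) : Frame n (Ultra A) where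
  r := canonicalRel
  D i j U := U.mem (d i j)
  equiv i := ⟨fun _ _ => Iff.rfl, fun h x => (h x).symm, fun h h' x => (h x).trans (h' x)⟩
  D_refl i U := by rw [h.c5]; exact U.mem_top
  D_symm i j U hU := by rwa [h.wc6_symm]
  D_trans i j k U h₁ h₂ := by
    by_cases hi : k = i
    · rwa [← hi]
    by_cases hj : k = j
    · rwa [← hj]
    exact U.mono (h.wc6_trans i j k hi hj) ((U.mem_inf _ _).2 ⟨h₁, h₂⟩)
  D_cyl i j k U V hi hj hUV hU := by
    rw [h.wc6_cyl i j k hi hj] at hU ⊢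
    exact (hUV _).1 hU
  D_uniq i j U V hij hUV hU hV := by
    refine Ultra.ext fun x hx => ?_
    by_contra hn
    refine V.not_bot ?_
    rw [← h.c7 i j x hij, V.mem_inf, ← hUV]
    exact ⟨U.mono (h.c2 _ _) ((U.mem_inf _ _).2 ⟨hU, hx⟩),
      V.mono (h.c2 _ _) ((V.mem_inf _ _).2 ⟨hV, (V.mem_compl _).2 hn⟩)⟩

theorem IsNCA.replete_canonical (h : IsNCA n A) : h.isWCA.canonical.Replete := fun i j hij U =>
  h.isWCA.exists_canonicalRel (by rw [h.c_d_eq_top hij]; exact U.mem_top)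

theorem IsWCA.sat_canonical (h : IsWCA n A) (e : Fin m → A) (s : Term n m) (U : Ultra A) :
    h.canonical.Sat (fun v => {U | U.mem (e v)}) s U ↔ U.mem (s.eval e) := by
  induction s generalizing U with
  | var v => exact Iff.rfl
  | zero => exact (iff_false_intro U.not_bot).symm
  | one => exact (iff_true_intro U.mem_top).symm
  | diag i j => exact Iff.rfl
  | neg s ih => exact (not_congr (ih U)).trans (U.mem_compl _).symm
  | cyl i s ih =>
    constructor
    · rintro ⟨V, hUV, hV⟩
      exact (hUV _).2 (V.mono (h.c2 _ _) ((ih V).1 hV))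
    · intro hU
      obtain ⟨V, hUV, hV⟩ := h.exists_canonicalRel hU
      exact ⟨V, hUV, (ih V).2 hV⟩
  | mul s t ihs iht => exact (and_congr (ihs U) (iht U)).trans (U.mem_inf _ _).symm
  | add s t ihs iht => exact (or_congr (ihs U) (iht U)).trans (U.mem_sup _ _).symm

theorem IsWCA.exists_sat (h : IsWCA n A) (e : Fin m → A) {s : Term n m} (hs : s.eval e ≠ ⊥) :
    ∃ e' U, h.canonical.Sat (m := m) e' s U := by
  obtain ⟨U, hU⟩ := Ultra.exists_of_filter (fun x => s.eval e ≤ x) le_top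
    (fun _ _ => le_inf) (fun _ _ h h' => h'.trans h) (fun hb => hs (le_bot_iff.1 hb))
  exact ⟨_, U, (h.sat_canonical e s U).2 (hU _ le_rfl)⟩

end Canonical

/-! ### Trees of paths -/

/-- Directed graphs with edges labelled by `Fin n`, whose vertices carry equivalence relations on
`Fin n`, such that the tree of paths is a frame. -/
structure StepSystem (n : ℕ) (X : Type u) where
  /-- `i` and `j` are equivalent at `x` when `fn x i = fn x j` -/
  fn : X → Fin n → Fin n
  /-- the edges -/
  St : Fin n → X → X → Prop
  cyl : ∀ {i j k x y}, St i x y → j ≠ i → k ≠ i → (fn x j = fn x k ↔ fn y j = fn y k)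
  -- `off` and `uniq` leave at most one point of `D i j` in an `i`-class of the tree: either its
  -- base or a single `i`-child.
  off : ∀ {i j x y}, St i x y → j ≠ i → fn x i = fn x j → fn y i ≠ fn y j
  uniq : ∀ {i j x y z}, j ≠ i → St i x y → St i x z → fn y i = fn y j → fn z i = fn z j → y = z

/-- Finite sequences of labelled steps. -/
inductive Path (n : ℕ) (X : Type u) : Type u where
  | root : X → Path n X
  | child : Path n X → Fin n → X → Path n X

namespace Path

variable {n : ℕ} {X : Type u}

/-- The endpoint of a path. -/
def last : Path n X → X
  | root x => x
  | child _ _ x => x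

/-- The last step of the path is not in direction `i`. -/
def Avoids (i : Fin n) : Path n X → Prop
  | root _ => True
  | child _ j _ => j ≠ i

/-- The path with its last step removed if that step is in direction `i`. -/
def base (i : Fin n) : Path n X → Path n X
  | root x => root x
  | child p j x => if j = i then p else child p j x

theorem base_of_avoids {i : Fin n} {p : Path n X} (h : p.Avoids i) : p.base i = p := by
  cases p with
  | root x => rfl
  | child p j x => exact if_neg h

@[simp] theorem base_child_self (i : Fin n) (p : Path n X) (x : X) :
    (child p i x).base i = p := if_pos rfl

end Path

namespace StepSystem

variable {n : ℕ} {X : Type u} (S : StepSystem n X) (x₀ : X)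

/-- Paths from `x₀` along edges, never with two consecutive steps in the same direction. -/
def Good : Path n X → Prop
  | .root x => x = x₀
  | .child p i x => Good p ∧ p.Avoids i ∧ S.St i p.last x

variable {S x₀}

/-- As consecutive steps differ in direction, one deletion leaves a path that does not end in
direction `i`. Hence an `i`-class consists of a node and its `i`-children. -/
theorem Good.base {p : Path n X} (hp : S.Good x₀ p) (i : Fin n) :
    S.Good x₀ (p.base i) ∧ (p.base i).Avoids i ∧
      (p = p.base i ∨ ∃ x, p = (p.base i).child i x ∧ S.St i (p.base i).last x) := by
  cases p with
  | root x => exact ⟨hp, trivial, Or.inl rfl⟩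
  | child p j x =>
    by_cases hj : j = i
    · subst hj
      rw [Path.base_child_self]
      exact ⟨hp.1, hp.2.1, Or.inr ⟨x, rfl, hp.2.2⟩⟩
    · rw [Path.base_of_avoids (p := p.child j x) hj]
      exact ⟨hp, hj, Or.inl rfl⟩

theorem Good.fn_base {p : Path n X} (hp : S.Good x₀ p) {i j k : Fin n} (hj : j ≠ i) (hk : k ≠ i) :
    S.fn p.last j = S.fn p.last k ↔ S.fn (p.base i).last j = S.fn (p.base i).last k := by
  obtain ⟨-, -, h | ⟨x, h, hx⟩⟩ := hp.base i
  · rw [← h]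
  · have hl : p.last = x := by rw [h]; rfl
    rw [hl]
    exact (S.cyl hx hj hk).symm

variable (S x₀) in
/-- The points of the tree of paths. -/
abbrev Node := {p : Path n X // S.Good x₀ p}

variable (S x₀) in
/-- The tree of paths as a frame. -/
def tree : Frame n (S.Node x₀) where
  r i p q := p.1.base i = q.1.base i
  D i j p := S.fn p.1.last i = S.fn p.1.last j
  equiv i := ⟨fun _ => rfl, Eq.symm, Eq.trans⟩
  D_refl _ _ := rfl
  D_symm _ _ _ := Eq.symm
  D_trans _ _ _ _ := Eq.trans
  D_cyl i j k p q hi hj hpq hp := by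
    rw [p.2.fn_base hi.symm hj.symm, hpq] at hp
    rwa [q.2.fn_base hi.symm hj.symm]
  D_uniq i j p q hij hpq hp hq := by
    refine Subtype.ext ?_
    obtain ⟨-, -, h₁⟩ := p.2.base i
    obtain ⟨-, -, h₂⟩ := q.2.base i
    rw [← hpq] at h₂
    rcases h₁ with h₁ | ⟨x, h₁, hx⟩ <;> rcases h₂ with h₂ | ⟨y, h₂, hy⟩
    · rw [h₁, h₂]
    · rw [h₁] at hp
      rw [h₂] at hq
      exact absurd hq (S.off hy hij.symm hp)
    · rw [h₂] at hq
      rw [h₁] at hp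
      exact absurd hp (S.off hx hij.symm hq)
    · have hxD : S.fn x i = S.fn x j := by rw [h₁] at hp; exact hp
      have hyD : S.fn y i = S.fn y j := by rw [h₂] at hq; exact hq
      rw [h₁, h₂, S.uniq hij.symm hx hy hxD hyD]

theorem replete_tree (h : ∀ i j x, j ≠ i → S.fn x i ≠ S.fn x j →
    ∃ y, S.St i x y ∧ S.fn y i = S.fn y j) : (S.tree x₀).Replete := by
  intro i j hij p
  obtain ⟨hb, ha, -⟩ := p.2.base i
  by_cases hD : S.fn (p.1.base i).last i = S.fn (p.1.base i).last j
  · exact ⟨⟨_, hb⟩, (Path.base_of_avoids ha).symm, hD⟩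
  · obtain ⟨y, hy, hD⟩ := h i j _ hij.symm hD
    exact ⟨⟨(p.1.base i).child i y, hb, ha, hy⟩, (Path.base_child_self i _ y).symm, hD⟩

end StepSystem

/-! ### Unravelling a frame to a given depth -/

/-- The endpoints of paths that go through a frame for a while, with a counter, and then through
the maps from `Fin n` to itself. -/
inductive Lab (n : ℕ) (W : Type u) : Type u where
  | old : W → ℕ → Lab n W
  | new : (Fin n → Fin n) → Lab n W

namespace Frame

variable {n : ℕ} {W : Type u} (F : Frame n W)

/-- The equivalence relation on `Fin n` given by the diagonals at a point. -/
def setoid (x : W) : Setoid (Fin n) where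
  r i j := F.D i j x
  iseqv := ⟨fun i => F.D_refl i x, F.D_symm _ _ x, F.D_trans _ _ _ x⟩

/-- A map whose kernel is given by the diagonals at a point. -/
noncomputable def kerMap (x : W) (i : Fin n) : Fin n := (Quotient.mk (F.setoid x) i).out

theorem kerMap_eq {x : W} {i j : Fin n} : F.kerMap x i = F.kerMap x j ↔ F.D i j x :=
  Quotient.out_inj.trans (Quotient.eq (r := F.setoid x))

/-- The map whose kernel is given by the diagonals. -/
noncomputable def labFn : Lab n W → Fin n → Fin n
  | .old x _ => F.kerMap x
  | .new g => g

/-- `k` steps in the frame, followed by steps in the set `G` of maps. -/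
def LabStep (k : ℕ) (G : Set (Fin n → Fin n)) (i : Fin n) : Lab n W → Lab n W → Prop
  -- A stationary step repeats the diagonals of `x`, so `off` admits it only if `x` is on no `D i j`
  -- with `j ≠ i`. Such steps are kept because `stay` descends by them. The conditions `g ≠ _` below
  -- serve `off` in the same way.
  | .old x l, .old y l' => l' = l + 1 ∧ l < k ∧ F.r i x y ∧ (x = y → ∀ j, j ≠ i → ¬ F.D i j x)
  | .old x l, .new g => k ≤ l ∧ g ∈ G ∧ (∀ j, j ≠ i → g j = F.kerMap x j) ∧ g ≠ F.kerMap x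
  | .new f, .new g => g ∈ G ∧ (∀ j, j ≠ i → g j = f j) ∧ g ≠ f
  | .new _, .old _ _ => False

variable {F} in
theorem labStep_new {k : ℕ} {G : Set (Fin n → Fin n)} {i : Fin n} {x : Lab n W}
    {g : Fin n → Fin n} (h : F.LabStep k G i x (.new g)) :
    g ∈ G ∧ (∀ j, j ≠ i → g j = F.labFn x j) ∧ g ≠ F.labFn x := by
  cases x with
  | old x l => exact h.2
  | new f => exact h

theorem eq_of_agree {f g h : Fin n → Fin n} {i j : Fin n} (hj : j ≠ i)
    (hg : ∀ k, k ≠ i → g k = f k) (hh : ∀ k, k ≠ i → h k = f k) (hgi : g i = g j)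
    (hhi : h i = h j) : g = h := by
  funext k
  by_cases hk : k = i
  · rw [hk, hgi, hhi, hg j hj, hh j hj]
  · rw [hg k hk, hh k hk]

/-- The step system whose tree imitates `F` up to depth `k`. -/
noncomputable def steps (k : ℕ) (G : Set (Fin n → Fin n)) : StepSystem n (Lab n W) where
  fn := F.labFn
  St := F.LabStep k G
  cyl {i j j' x y} h hj hj' := by
    cases y with
    | new g =>
      obtain ⟨-, h, -⟩ := labStep_new h
      simp only [labFn] at *
      rw [h j hj, h j' hj']
    | old y l' =>
      cases x with
      | new f => exact h.elim
      | old x l =>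
        simp only [labFn, kerMap_eq]
        exact ⟨F.D_cyl _ _ _ _ _ hj.symm hj'.symm h.2.2.1,
          F.D_cyl _ _ _ _ _ hj.symm hj'.symm ((F.equiv i).symm h.2.2.1)⟩
  off {i j x y} h hj hx hy := by
    cases y with
    | new g =>
      obtain ⟨-, h, hne⟩ := labStep_new h
      exact hne (eq_of_agree hj h (fun _ _ => rfl) hy hx)
    | old y l' =>
      cases x with
      | new f => exact h.elim
      | old x l =>
        simp only [labFn, kerMap_eq] at hx hy
        exact h.2.2.2 (F.D_uniq _ _ _ _ hj.symm h.2.2.1 hx hy) j hj hx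
  uniq {i j x y z} hj hy hz hyi hzi := by
    cases x with
    | new f =>
      cases y with
      | old y l => exact hy.elim
      | new g =>
        cases z with
        | old z l => exact hz.elim
        | new h => rw [eq_of_agree hj hy.2.1 hz.2.1 hyi hzi]
    | old x l =>
      cases y with
      | new g =>
        cases z with
        | old z l' => exact absurd hz.2.1 (not_lt.2 hy.1)
        | new h => rw [eq_of_agree hj hy.2.2.1 hz.2.2.1 hyi hzi]
      | old y l₁ =>
        cases z with
        | new g => exact absurd hy.2.1 (not_lt.2 hz.1)
        | old z l₂ =>
          simp only [labFn, kerMap_eq] at hyi hzi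
          rw [F.D_uniq _ _ _ _ hj.symm ((F.equiv i).trans ((F.equiv i).symm hy.2.2.1) hz.2.2.1)
            hyi hzi, hy.1, hz.1]

variable {F} in
-- Below level `k`, giving `i` the value of `j` produces the required point. The new map is not
-- injective, so `G` need not contain injective maps.
theorem Replete.exists_labStep (hF : F.Replete) (k : ℕ) {G : Set (Fin n → Fin n)}
    (hG : ∀ g, ¬ Function.Injective g → g ∈ G) {i j : Fin n} (x : Lab n W) (hj : j ≠ i)
    (hx : F.labFn x i ≠ F.labFn x j) :
    ∃ y, F.LabStep k G i x y ∧ F.labFn y i = F.labFn y j := by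
  have key (f : Fin n → Fin n) (hf : f i ≠ f j) : ∃ g, (g ∈ G ∧ (∀ j, j ≠ i → g j = f j) ∧
      g ≠ f) ∧ g i = g j := by
    have h : Function.update f i (f j) i = Function.update f i (f j) j := by
      simp [Function.update_of_ne hj]
    refine ⟨Function.update f i (f j), ⟨hG _ fun hinj => hj (hinj h).symm,
      fun j hj => Function.update_of_ne hj _ _, fun he => ?_⟩, h⟩
    rw [he] at h
    exact hf h
  cases x with
  | new f =>
    obtain ⟨g, hg, hgi⟩ := key f hx
    exact ⟨.new g, hg, hgi⟩
  | old x l =>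
    by_cases hl : l < k
    · obtain ⟨y, hxy, hy⟩ := hF i j hj.symm x
      refine ⟨.old y (l + 1), ⟨rfl, hl, hxy, fun h => ?_⟩, F.kerMap_eq.2 hy⟩
      exact absurd (F.kerMap_eq.2 (h ▸ hy)) hx
    · obtain ⟨g, hg, hgi⟩ := key (F.kerMap x) hx
      exact ⟨.new g, ⟨not_lt.1 hl, hg⟩, hgi⟩

/-- The frame that imitates `F` up to depth `k` from the point `w`. -/
noncomputable abbrev unravel (w : W) (k : ℕ) (G : Set (Fin n → Fin n)) :
    Frame n ((F.steps k G).Node (.old w 0)) := (F.steps k G).tree (.old w 0)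

variable {F} in
theorem Replete.unravel (hF : F.Replete) (w : W) (k : ℕ) {G : Set (Fin n → Fin n)}
    (hG : ∀ g, ¬ Function.Injective g → g ∈ G) : (F.unravel w k G).Replete :=
  StepSystem.replete_tree fun _ _ x => hF.exists_labStep k hG x

end Frame

/-! ### The separating terms -/

namespace Term

variable {n m : ℕ}

/-- The nesting depth of cylindrifications. -/
def depth : Term n m → ℕ
  | var _ => 0
  | zero => 0
  | one => 0
  | diag _ _ => 0
  | neg s => s.depth
  | cyl _ s => s.depth + 1
  | mul s t => max s.depth t.depth
  | add s t => max s.depth t.depth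

/-- The conjunction of a list of terms. -/
def conj (L : List (Term n m)) : Term n m := L.foldr mul one

variable (n m) in
/-- The term `∏_{i < j < n} -d_ij`. -/
noncomputable def offTerm : Term n m :=
  conj ((Finset.univ.filter fun p : Fin n × Fin n => p.1 < p.2).toList.map
    fun p => neg (diag p.1 p.2))

/-- There is a walk of `2 * N` alternating steps in the directions `i` and `j` that is
alternatingly off all diagonals and on the `ij`-diagonal. -/
noncomputable def walk (i j : Fin n) : ℕ → Term n m
  | 0 => offTerm n m
  | N + 1 => mul (offTerm n m) (cyl i (mul (diag i j) (cyl j (walk i j N))))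

/-- A point satisfying `t` is reached by `2 * h` alternating steps in the directions `i`, `j`. -/
def reach (i j : Fin n) (t : Term n m) : ℕ → Term n m
  | 0 => t
  | h + 1 => cyl i (cyl j (reach i j t h))

end Term

namespace Frame

variable {n m : ℕ} {W : Type u} (F : Frame n W)

/-- The point lies on no diagonal. -/
def Off (x : W) : Prop := ∀ i j, i ≠ j → ¬ F.D i j x

theorem sat_conj {e : Fin m → Set W} {L : List (Term n m)} {x : W} :
    F.Sat e (Term.conj L) x ↔ ∀ s ∈ L, F.Sat e s x := by
  induction L with
  | nil => simp [Term.conj, Sat]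
  | cons s L ih =>
    rw [List.forall_mem_cons, ← ih]
    exact Iff.rfl

theorem sat_offTerm {e : Fin m → Set W} {x : W} : F.Sat e (Term.offTerm n m) x ↔ F.Off x := by
  rw [Term.offTerm, sat_conj]
  constructor
  · intro h i j hij hD
    rcases lt_or_gt_of_ne hij with hlt | hlt
    · exact h (.neg (.diag i j)) (List.mem_map.2 ⟨(i, j), by simpa using hlt, rfl⟩) hD
    · exact h (.neg (.diag j i)) (List.mem_map.2 ⟨(j, i), by simpa using hlt, rfl⟩)
        (F.D_symm _ _ _ hD)
  · intro h s hs
    obtain ⟨p, hp, rfl⟩ := List.mem_map.1 hs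
    exact h p.1 p.2 (by simpa using hp : p.1 < p.2).ne

theorem Sat.off_of_walk {F : Frame n W} {e : Fin m → Set W} {x : W} {i j : Fin n} {N : ℕ}
    (h : F.Sat e (Term.walk i j N) x) : F.Off x := by
  cases N with
  | zero => exact F.sat_offTerm.1 h
  | succ N => exact F.sat_offTerm.1 h.1

theorem Sat.exists_of_reach {F : Frame n W} {e : Fin m → Set W} {x : W} {i j : Fin n}
    {t : Term n m} {h : ℕ} (hx : F.Sat e (Term.reach i j t h) x) : ∃ y, F.Sat e t y := by
  induction h generalizing x with
  | zero => exact ⟨x, hx⟩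
  | succ h ih =>
    obtain ⟨y, -, z, -, hz⟩ := hx
    exact ih hz

/-! ### Truth in the unravelling -/

section Unravel

variable {F} {w : W} {k : ℕ} {G : Set (Fin n → Fin n)}

theorem labStep_old {i : Fin n} {a : Lab n W} {y : W} {l : ℕ}
    (h : F.LabStep k G i a (.old y l)) :
    ∃ x l', a = .old x l' ∧ l = l' + 1 ∧ l ≤ k ∧ F.r i x y := by
  cases a with
  | new f => exact h.elim
  | old x l' => exact ⟨x, l', rfl, h.1, h.1 ▸ h.2.1, h.2.2.1⟩

theorem level_le {p : Path n (Lab n W)} (hp : (F.steps k G).Good (.old w 0) p) {x : W} {l : ℕ}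
    (hl : p.last = .old x l) : l ≤ k := by
  cases p with
  | root a =>
    have : Lab.old x l = .old w 0 := hl.symm.trans hp
    cases this
    exact zero_le
  | child p i a =>
    obtain rfl : a = .old x l := hl
    exact (labStep_old hp.2.2).choose_spec.choose_spec.2.2.1

theorem base_last {p : Path n (Lab n W)} (hp : (F.steps k G).Good (.old w 0) p) {x : W} {l : ℕ}
    (hl : p.last = .old x l) (i : Fin n) :
    ∃ x' l', (p.base i).last = .old x' l' ∧ l' ≤ l ∧ F.r i x' x := by
  obtain ⟨-, -, h | ⟨y, h, hy⟩⟩ := hp.base i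
  · exact ⟨x, l, h ▸ hl, le_rfl, (F.equiv i).refl x⟩
  · obtain rfl : y = .old x l := by rw [h] at hl; exact hl
    obtain ⟨x', l', hb, hl', -, hr⟩ := labStep_old hy
    exact ⟨x', l', hb, by omega, hr⟩

variable (F w k G) in
/-- The valuation on the unravelling given by a valuation on the frame. -/
def liftVal (e : Fin m → Set W) (v : Fin m) : Set ((F.steps k G).Node (.old w 0)) :=
  {p | ∃ x l, p.1.last = .old x l ∧ x ∈ e v}

/-- Each cylindrification leads at most one level deeper, so the bound on `s.depth + l` confines the
evaluation to the part where steps imitate `F`. -/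
theorem sat_unravel (e : Fin m → Set W) (s : Term n m) (p : (F.steps k G).Node (.old w 0))
    {x : W} {l : ℕ} (hp : p.1.last = .old x l) (hs : s.depth + l ≤ k) :
    (F.unravel w k G).Sat (F.liftVal w k G e) s p ↔ F.Sat e s x := by
  induction s generalizing p x l with
  | var v =>
    constructor
    · rintro ⟨x', l', h, hx⟩
      rw [hp] at h
      cases h
      exact hx
    · exact fun h => ⟨x, l, hp, h⟩
  | zero => exact Iff.rfl
  | one => exact Iff.rfl
  | diag i j =>
    change F.labFn p.1.last i = F.labFn p.1.last j ↔ _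
    rw [hp]
    exact F.kerMap_eq
  | neg s ih => exact not_congr (ih p hp hs)
  | mul s t ihs iht =>
    simp only [Term.depth] at hs
    exact and_congr (ihs p hp (by omega)) (iht p hp (by omega))
  | add s t ihs iht =>
    simp only [Term.depth] at hs
    exact or_congr (ihs p hp (by omega)) (iht p hp (by omega))
  | cyl i s ih =>
    simp only [Term.depth] at hs
    obtain ⟨x', l', hb, hl', hr⟩ := base_last p.2 hp i
    constructor
    · rintro ⟨q, hpq, hq⟩
      have hpq : p.1.base i = q.1.base i := hpq
      have : ∃ y l'', q.1.last = .old y l'' ∧ l'' ≤ l' + 1 ∧ F.r i x' y := by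
        obtain ⟨-, -, h⟩ := q.2.base i
        rw [← hpq] at h
        rcases h with h | ⟨y, h, hy⟩
        · exact ⟨x', l', h ▸ hb, Nat.le_succ _, (F.equiv i).refl _⟩
        · rw [hb] at hy
          cases y with
          | new g => exact absurd hy.1 (by omega)
          | old y l'' => exact ⟨y, l'', by rw [h]; rfl, hy.1.le, hy.2.2.1⟩
      obtain ⟨y, l'', hy, hle, hry⟩ := this
      exact ⟨y, (F.equiv i).trans ((F.equiv i).symm hr) hry, (ih q hy (by omega)).1 hq⟩
    · rintro ⟨y, hxy, hy⟩
      obtain ⟨hgood, hav, -⟩ := p.2.base i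
      -- If `x' = y`, the base itself is the witness; a stationary step might be forbidden.
      by_cases hyx : x' = y
      · subst hyx
        exact ⟨⟨_, hgood⟩, (Path.base_of_avoids hav).symm, (ih ⟨_, hgood⟩ hb (by omega)).2 hy⟩
      · have hst : F.LabStep k G i (p.1.base i).last (.old y (l' + 1)) := by
          rw [hb]
          exact ⟨rfl, by omega, (F.equiv i).trans hr hxy, fun h => absurd h hyx⟩
        refine ⟨⟨(p.1.base i).child i (.old y (l' + 1)), hgood, hav, hst⟩,
          (Path.base_child_self i _ _).symm, (ih _ (l := l' + 1) ?_ (by omega)).2 hy⟩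
        rfl

end Unravel

/-! ### Walks are bounded if the maps are not injective -/

section Bounded

variable {F} {w : W} {k : ℕ} {e : Fin m → Set ((F.steps k {g | ¬ Function.Injective g}).Node
  (.old w 0))} {i j : Fin n}

theorem exists_last_of_off {p : (F.steps k {g | ¬ Function.Injective g}).Node (.old w 0)}
    (hp : (F.unravel w k {g | ¬ Function.Injective g}).Off p) :
    ∃ x l, p.1.last = .old x l ∧ l ≤ k := by
  obtain ⟨p, hgood⟩ := p
  cases hl : p.last with
  | old x l => exact ⟨x, l, rfl, level_le hgood hl⟩
  | new g =>
    have hg : ¬ Function.Injective g := by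
      cases p with
      | root a => cases (show Lab.new g = .old w 0 from hl.symm.trans hgood)
      | child p i a =>
        obtain rfl : a = .new g := hl
        exact (labStep_new hgood.2.2).1
    refine absurd (fun a b hab => ?_) hg
    by_contra hne
    refine hp a b hne ?_
    change F.labFn p.last a = F.labFn p.last b
    rw [hl]
    exact hab

/-- Both legs of a double step must move, since exactly one end of each lies on `D i j`. From a node
not ending in direction `i` they can only go to an `i`-child and then to a `j`-child of it, so every
double step descends two levels. -/
theorem walk_le_of_avoids (hij : i ≠ j) (N : ℕ)
    {p : (F.steps k {g | ¬ Function.Injective g}).Node (.old w 0)} (hav : p.1.Avoids i)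
    {x : W} {l : ℕ} (hl : p.1.last = .old x l)
    (hp : (F.unravel w k {g | ¬ Function.Injective g}).Sat e (Term.walk i j N) p) :
    l + 2 * N ≤ k := by
  induction N generalizing p x l with
  | zero => exact level_le p.2 hl
  | succ N ih =>
    obtain ⟨hoff, q, hpq, hq, r, hqr, hr⟩ := hp
    rw [sat_offTerm] at hoff
    have hpq : p.1.base i = q.1.base i := hpq
    have hqr : q.1.base j = r.1.base j := hqr
    have hqD : (F.unravel w k {g | ¬ Function.Injective g}).D i j q := hq
    rw [Path.base_of_avoids hav] at hpq
    obtain ⟨-, -, h | ⟨y, h, hy⟩⟩ := q.2.base i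
    · rw [← hpq] at h
      exact absurd (Subtype.ext h ▸ hqD) (hoff i j hij)
    have hqa : q.1.Avoids j := by rw [h]; exact hij
    have hqy : q.1.last = y := by rw [h]; rfl
    rw [Path.base_of_avoids hqa] at hqr
    obtain ⟨-, -, h' | ⟨z, h', hz⟩⟩ := r.2.base j
    · rw [← hqr] at h'
      exact absurd (Subtype.ext h' ▸ hqD) (hr.off_of_walk i j hij)
    have hrz : r.1.last = z := by rw [h']; rfl
    obtain ⟨z', l', hl', -⟩ := exists_last_of_off hr.off_of_walk
    have := ih (by rw [h']; exact hij.symm) hl' hr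
    rw [← hqr, hqy, ← hrz, hl'] at hz
    obtain ⟨y', l₁, rfl, hl₁, -⟩ := labStep_old hz
    rw [← hpq, hl] at hy
    have := hy.1
    omega

/-- A walk may first climb towards the root, two levels per double step. Once it turns downwards it
can only descend, and `walk_le_of_avoids` applies. -/
theorem walk_le (hij : i ≠ j) (N : ℕ)
    {p : (F.steps k {g | ¬ Function.Injective g}).Node (.old w 0)} {x : W} {l : ℕ}
    (hl : p.1.last = .old x l)
    (hp : (F.unravel w k {g | ¬ Function.Injective g}).Sat e (Term.walk i j N) p) :
    N ≤ l + k + 1 := by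
  induction N generalizing p x l with
  | zero => exact zero_le
  | succ N ih =>
    obtain ⟨-, hpa, h | ⟨a, h, ha⟩⟩ := p.2.base i
    · rw [← h] at hpa
      have := walk_le_of_avoids hij (N + 1) hpa hl hp
      omega
    obtain ⟨hoff, q, hpq, hq, r, hqr, hr⟩ := hp
    have hpq : p.1.base i = q.1.base i := hpq
    have hqr : q.1.base j = r.1.base j := hqr
    have hqD : (F.unravel w k {g | ¬ Function.Injective g}).D i j q := hq
    have hqne : q.1 ≠ r.1 := fun he =>
      absurd (Subtype.ext he ▸ hqD) (hr.off_of_walk i j hij)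
    obtain ⟨z, l', hl', -⟩ := exists_last_of_off hr.off_of_walk
    obtain ⟨-, -, h₁ | ⟨b, h₁, -⟩⟩ := r.2.base j
    swap
    · have := walk_le_of_avoids hij N (by rw [h₁]; exact hij.symm) hl' hr
      omega
    -- In the remaining case `p` is an `i`-child of `q` and `q` a `j`-child of `r`: the walk climbs.
    rw [← hqr] at h₁
    obtain ⟨-, -, h₂ | ⟨b, h₂, -⟩⟩ := q.2.base i
    swap
    · rw [Path.base_of_avoids (by rw [h₂]; exact hij)] at h₁
      exact absurd h₁.symm hqne
    obtain ⟨-, -, h₃ | ⟨b, h₃, hb⟩⟩ := q.2.base j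
    · exact absurd (h₃.trans h₁.symm) hqne
    have hqb : q.1.last = b := by rw [h₃]; rfl
    have hpl : p.1.last = a := by rw [h]; rfl
    rw [hpq, ← h₂, hqb, ← hpl, hl] at ha
    obtain ⟨y, l₁, rfl, hl₁, -⟩ := labStep_old ha
    rw [← h₁, hl'] at hb
    have := hb.1
    have := ih hl' hr
    omega

end Bounded

/-! ### Walks of any length if all maps are allowed -/

section Unbounded

variable {F} {w : W} {k : ℕ} {i j : Fin n}

/-- Steps from the label lead to maps. -/
def Late (k : ℕ) : Lab n W → Prop
  | .old _ l => k ≤ l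
  | .new _ => True

theorem labStep_of_late {a : Lab n W} (ha : Late k a) {g : Fin n → Fin n}
    (hg : ∀ j, j ≠ i → g j = F.labFn a j) (hne : g ≠ F.labFn a) :
    F.LabStep k Set.univ i a (.new g) := by
  cases a with
  | old x l => exact ⟨ha, trivial, hg, hne⟩
  | new f => exact ⟨trivial, hg, hne⟩

/-- From an injective `f`, giving `i` the value `f j` lands on `D i j`; then giving `j` the value `f
i` yields `f ∘ Equiv.swap i j`, which is injective again. -/
theorem sat_walk (hij : i ≠ j) (e : Fin m → Set ((F.steps k Set.univ).Node (.old w 0))) (N : ℕ)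
    {p : (F.steps k Set.univ).Node (.old w 0)} (hav : p.1.Avoids i) (hl : Late k p.1.last)
    (hinj : Function.Injective (F.labFn p.1.last)) :
    (F.unravel w k Set.univ).Sat e (Term.walk i j N) p := by
  have hoff : (F.unravel w k Set.univ).Off p := fun a b hab h => hab (hinj h)
  induction N generalizing p with
  | zero => exact (sat_offTerm _).2 hoff
  | succ N ih =>
    have hf : F.labFn p.1.last i ≠ F.labFn p.1.last j := hinj.ne hij
    obtain ⟨f, hfdef⟩ : ∃ f, f = F.labFn p.1.last := ⟨_, rfl⟩
    rw [← hfdef] at hf hinj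
    have hst₁ : F.LabStep k Set.univ i p.1.last (.new (Function.update f i (f j))) := by
      refine labStep_of_late hl (fun a ha => ?_) fun he => hf ?_
      · rw [Function.update_of_ne ha, hfdef]
      · rw [← hfdef] at he
        rw [← congrFun he i, Function.update_self]
    have hst₂ : F.LabStep (W := W) k Set.univ j (.new (Function.update f i (f j)))
        (.new (f ∘ Equiv.swap i j)) := by
      refine labStep_of_late (a := .new _) trivial (fun a ha => ?_) fun he => hf ?_
      · by_cases hai : a = i
        · simp [labFn, hai]
        · simp [labFn, hai, ha, Equiv.swap_apply_of_ne_of_ne]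
      · have := congrFun he j
        simpa [labFn, Function.update_of_ne hij.symm] using this
    let q : (F.steps k Set.univ).Node (.old w 0) :=
      ⟨.child p.1 i (.new (Function.update f i (f j))), p.2, hav, hst₁⟩
    let r : (F.steps k Set.univ).Node (.old w 0) :=
      ⟨.child q.1 j (.new (f ∘ Equiv.swap i j)), q.2, hij, hst₂⟩
    have hrinj : Function.Injective (F.labFn r.1.last) :=
      hinj.comp (Equiv.swap i j).injective
    refine ⟨(sat_offTerm _).2 hoff, q, ?_, ?_, r, ?_,
      ih hij.symm trivial hrinj fun a b hab h => hab (hrinj h)⟩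
    · exact (Path.base_of_avoids hav).trans (Path.base_child_self i _ _).symm
    · change Function.update f i (f j) i = Function.update f i (f j) j
      rw [Function.update_self, Function.update_of_ne hij.symm]
    · exact (Path.base_of_avoids (p := q.1) hij).trans (Path.base_child_self j _ _).symm

variable (w i j) in
/-- The path that stays at `w`, making `2 * h` steps. -/
def stay : ℕ → Path n (Lab n W)
  | 0 => .root (.old w 0)
  | h + 1 => .child (.child (stay h) i (.old w (2 * h + 1))) j (.old w (2 * h + 2))

theorem last_stay (h : ℕ) : (stay w i j h).last = .old w (2 * h) := by cases h <;> rfl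

theorem avoids_stay (hij : i ≠ j) (h : ℕ) : (stay w i j h).Avoids i := by
  cases h with
  | zero => trivial
  | succ h => exact hij.symm

theorem good_stay {G : Set (Fin n → Fin n)} (hij : i ≠ j) (hw : F.Off w) {h : ℕ}
    (hh : 2 * h ≤ k) : (F.steps k G).Good (.old w 0) (stay w i j h) := by
  induction h with
  | zero => rfl
  | succ h ih =>
    have hstep {a : Fin n} {l : ℕ} (hl : l < k) :
        F.LabStep k G a (.old w l) (.old w (l + 1)) :=
      ⟨rfl, hl, (F.equiv a).refl w, fun _ b hb => hw a b hb.symm⟩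
    refine ⟨⟨ih (by omega), avoids_stay hij h, ?_⟩, hij, hstep (by omega)⟩
    rw [last_stay]
    exact hstep (by omega)

/-- The offset `h'` lets the induction start at any node of the stationary path, not only at the
root. -/
theorem sat_reach {G : Set (Fin n → Fin n)} (hij : i ≠ j) (hw : F.Off w)
    {e : Fin m → Set ((F.steps k G).Node (.old w 0))} {t : Term n m} (h h' : ℕ)
    (hh : 2 * (h' + h) ≤ k)
    (ht : (F.unravel w k G).Sat e t ⟨stay w i j (h' + h), good_stay hij hw hh⟩) :
    (F.unravel w k G).Sat e (Term.reach i j t h)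
      ⟨stay w i j h', good_stay hij hw (by omega)⟩ := by
  induction h generalizing h' with
  | zero => exact ht
  | succ h ih =>
    have hgood := good_stay (F := F) (G := G) hij hw (show 2 * (h' + 1) ≤ k by omega)
    refine ⟨⟨_, hgood.1⟩, ?_, ⟨_, hgood⟩, ?_, ih (h' + 1) (by omega) ?_⟩
    · exact (Path.base_of_avoids (avoids_stay hij h')).trans (Path.base_child_self i _ _).symm
    · exact (Path.base_of_avoids (p := .child _ i _) hij).trans
        (Path.base_child_self j _ _).symm
    · convert ht using 3
      omega

end Unbounded

/-- Every term satisfied off the diagonals is split by another term. -/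
theorem exists_split {i j : Fin n} (hij : i ≠ j) (s : Term n m) :
    ∃ b : Term n m, ∀ (W : Type) (F : Frame n W) (e : Fin m → Set W) (w : W),
      F.Sat e s w → F.Off w →
      (∃ (V : Type) (H : Frame n V) (e' : Fin m → Set V) (v : V),
        (F.Replete → H.Replete) ∧ H.Sat e' s v ∧ H.Sat e' b v) ∧
      (∃ (V : Type) (H : Frame n V) (e' : Fin m → Set V) (v : V),
        (F.Replete → H.Replete) ∧ H.Sat e' s v ∧ ¬ H.Sat e' b v) := by
  obtain ⟨h, hh⟩ : ∃ h, h = s.depth := ⟨_, rfl⟩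
  -- Unravelling to level `2 * h` lets `h` stationary double steps end exactly where the maps begin.
  -- With non-injective maps, `walk_le` bounds walks by `l + 2 * h + 1 ≤ 4 * h + 1`.
  refine ⟨Term.reach i j (Term.walk i j (4 * h + 2)) h, fun W F e w hs hw => ⟨?_, ?_⟩⟩
  · refine ⟨_, F.unravel w (2 * h) Set.univ, F.liftVal w _ _ e, ⟨.root (.old w 0), rfl⟩,
      fun hF => hF.unravel w _ fun _ _ => trivial,
      (sat_unravel e s _ (l := 0) rfl (by omega)).2 hs, ?_⟩
    refine sat_reach hij hw h 0 (by omega) (sat_walk hij _ _ (avoids_stay hij _) ?_ ?_)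
    · rw [last_stay, zero_add]
      exact le_refl (2 * h)
    · rw [last_stay]
      intro a b hab
      by_contra hne
      exact hw a b hne (F.kerMap_eq.1 hab)
  · refine ⟨_, F.unravel w (2 * h) {g | ¬ Function.Injective g}, F.liftVal w _ _ e,
      ⟨.root (.old w 0), rfl⟩, fun hF => hF.unravel w _ fun _ hg => hg,
      (sat_unravel e s _ (l := 0) rfl (by omega)).2 hs, fun hb => ?_⟩
    obtain ⟨p, hp⟩ := hb.exists_of_reach
    obtain ⟨x, l, hl, hle⟩ := exists_last_of_off hp.off_of_walk
    have := walk_le hij _ hl hp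
    omega

variable (n) in
/-- The frame of all maps from `Fin n` to itself. -/
def full : Frame n (Fin n → Fin n) where
  r i f g := ∀ j, j ≠ i → f j = g j
  D i j f := f i = f j
  equiv i := ⟨fun _ _ _ => rfl, fun h j hj => (h j hj).symm,
    fun h h' j hj => (h j hj).trans (h' j hj)⟩
  D_refl _ _ := rfl
  D_symm _ _ _ := Eq.symm
  D_trans _ _ _ _ := Eq.trans
  D_cyl i j k f g hi hj h hf := by rw [← h i hi.symm, ← h j hj.symm, hf]
  D_uniq i j f g hij h hf hg := by
    refine funext fun k => ?_
    by_cases hk : k = i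
    · rw [hk, hf, hg, h j hij.symm]
    · exact h k hk

theorem replete_full : (full n).Replete := fun i j hij f =>
  ⟨Function.update f i (f j), fun _ hk => (Function.update_of_ne hk _ _).symm, by
    simp [full, Function.update_of_ne hij.symm]⟩

theorem off_full : (full n).Off id := fun _ _ h => h

end Frame

variable {n m : ℕ}

namespace Term

variable {A : Type u} [BooleanAlgebra A] [CylOps n A]

theorem le_eval_conj (e : Fin m → A) (L : List (Term n m)) (x : A) :
    x ≤ (conj L).eval e ↔ ∀ s ∈ L, x ≤ s.eval e := by
  induction L with
  | nil => simp [conj, eval]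
  | cons s L ih =>
    rw [List.forall_mem_cons, ← ih, ← le_inf_iff]
    exact Iff.rfl

theorem eval_conj_toList (e : Fin m → A) (T : Finset (Term n m)) :
    (conj T.toList).eval e = T.inf fun φ => φ.eval e :=
  eq_of_forall_le_iff fun x => by simp [le_eval_conj]

end Term

/-! ### Atoms of the free algebra -/

namespace Fr

variable {K : AlgClass n}

theorem mk_le_mk {s t : Term n m} : mk K s ≤ mk K t ↔
    ∀ (A : Type) [BooleanAlgebra A] [CylOps n A], K A →
      ∀ e : Fin m → A, s.eval e ≤ t.eval e := by
  refine (mk_eq_mk (s := s.mul t)).trans ?_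
  simp only [Term.eval, inf_eq_left]

theorem le_mk_conj (L : List (Term n m)) (x : Fr K m) :
    x ≤ mk K (Term.conj L) ↔ ∀ s ∈ L, x ≤ mk K s := by
  induction L with
  | nil => exact iff_of_true le_top (by simp)
  | cons s L ih =>
    rw [List.forall_mem_cons, ← ih, ← le_inf_iff]
    exact Iff.rfl

variable (K m) in
theorem offDiag_eq_mk : offDiag n (Fr K m) = mk K (Term.offTerm n m) := by
  refine eq_of_forall_le_iff fun x => ?_
  rw [offDiag, Finset.le_inf_iff, Term.offTerm, le_mk_conj, List.forall_mem_map]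
  simp only [Finset.mem_toList]
  exact Iff.rfl

/-- A formula is a consequence of `T` when it is above the meet of `T` in the free algebra. -/
theorem proves_iff {T : Finset (Term n m)} {ψ : Term n m} :
    Proves K T ψ ↔ mk K (Term.conj T.toList) ≤ mk K ψ := by
  rw [mk_le_mk]
  simp only [Term.eval_conj_toList]
  exact Iff.rfl

theorem consistent_iff {T : Finset (Term n m)} :
    Consistent K T ↔ mk K (Term.conj T.toList) ≠ ⊥ :=
  not_congr (proves_iff.trans le_bot_iff)

theorem isAtom_of_complete {T : Finset (Term n m)} (hT : Consistent K T) (hc : Complete K T) :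
    IsAtom (mk K (Term.conj T.toList)) := by
  refine ⟨consistent_iff.1 hT, ?_⟩
  rintro ⟨ψ⟩ hψ
  change mk K ψ = ⊥
  change mk K ψ < _ at hψ
  rcases hc ψ with h | h
  · exact absurd (proves_iff.1 h) hψ.not_ge
  · have h : mk K (Term.conj T.toList) ≤ (mk K ψ)ᶜ := proves_iff.1 h
    have := le_inf le_rfl (hψ.le.trans h)
    rwa [inf_compl_eq_bot, le_bot_iff] at this

section Frames

variable (hK : K = @IsNCA n ∨ K = @IsWCA n)
include hK

theorem mem_class {W : Type} {F : Frame n W} (hF : K = @IsNCA n → F.Replete) :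
    @K (Set W) _ F.cylOps := by
  rcases hK with rfl | rfl
  · exact (hF rfl).isNCA
  · exact F.isWCA

/-- Canonical frames give one direction, complex algebras the other. -/
theorem mk_ne_bot_iff {s : Term n m} : mk K s ≠ ⊥ ↔
    ∃ (W : Type) (F : Frame n W) (e : Fin m → Set W) (w : W),
      (K = @IsNCA n → F.Replete) ∧ F.Sat e s w := by
  constructor
  · intro hs
    by_contra hn
    refine hs (mk_eq_mk.2 fun A _ _ hA e => ?_)
    by_contra hne
    have hw : IsWCA n A := by
      rcases hK with rfl | rfl
      · exact IsNCA.isWCA hA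
      · exact hA
    obtain ⟨e', U, hU⟩ := hw.exists_sat e hne
    refine hn ⟨_, hw.canonical, e', U, ?_, hU⟩
    rintro rfl
    exact IsNCA.replete_canonical hA
  · rintro ⟨W, F, e, w, hF, hs⟩ hbot
    have := @mk_eq_mk.1 hbot (Set W) _ F.cylOps (mem_class hK hF) e
    have hs := (F.mem_eval e s w).2 hs
    rw [this] at hs
    exact hs

theorem not_isAtom_of_le_offDiag (hn : 2 ≤ n) {a : Fr K m} (ha : a ≤ offDiag n (Fr K m)) :
    ¬ IsAtom a := by
  obtain ⟨s, rfl⟩ : ∃ s, a = mk K s := ⟨_, (Quotient.out_eq a).symm⟩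
  intro hatom
  rw [offDiag_eq_mk, mk_le_mk] at ha
  obtain ⟨W, F, e, w, hF, hs⟩ := (mk_ne_bot_iff hK).1 hatom.1
  have hoff : F.Off w := by
    have := @ha (Set W) _ F.cylOps (mem_class hK hF) e w ((F.mem_eval e s w).2 hs)
    exact F.sat_offTerm.1 ((F.mem_eval e _ w).1 this)
  have hij : (⟨0, by omega⟩ : Fin n) ≠ ⟨1, by omega⟩ := by simp
  obtain ⟨b, hb⟩ := Frame.exists_split hij s
  obtain ⟨⟨V, H, e₁, v, hH, h₁⟩, V', H', e₂, v', hH', h₂⟩ := hb W F e w hs hoff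
  have hne₁ : mk K s ⊓ mk K b ≠ ⊥ :=
    (mk_ne_bot_iff hK (s := s.mul b)).2 ⟨V, H, e₁, v, fun h => hH (hF h), h₁⟩
  have hne₂ : mk K s ⊓ (mk K b)ᶜ ≠ ⊥ :=
    (mk_ne_bot_iff hK (s := s.mul b.neg)).2 ⟨V', H', e₂, v', fun h => hH' (hF h), h₂⟩
  have hle := inf_eq_left.1 ((hatom.le_iff.1 inf_le_left).resolve_left hne₁)
  exact hne₂ (disjoint_iff.1 (disjoint_compl_right_iff.2 hle))

theorem offDiag_ne_bot : offDiag n (Fr K m) ≠ ⊥ := by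
  rw [offDiag_eq_mk, mk_ne_bot_iff hK]
  exact ⟨_, Frame.full n, fun _ => ∅, id, fun _ => Frame.replete_full,
    (Frame.sat_offTerm _).2 Frame.off_full⟩

end Frames

end Fr

end CylAlg

theorem mainTheorem2 (n : ℕ) (hn : 2 ≤ n) (K : CylAlg.AlgClass n)
    (hK : K = @CylAlg.IsNCA n ∨ K = @CylAlg.IsWCA n) (m : ℕ) :
    (¬ ∃ a : CylAlg.Fr K m, IsAtom a ∧ a ≤ CylAlg.offDiag n (CylAlg.Fr K m)) ∧
      ¬ IsAtomic (CylAlg.Fr K m) ∧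
      CylAlg.WeakGoedelIncompleteness K m := by
  refine ⟨fun ⟨a, ha, hle⟩ => CylAlg.Fr.not_isAtom_of_le_offDiag hK hn hle ha, fun hat => ?_,
    CylAlg.Term.offTerm n m, ?_, fun T hT hp hc => ?_⟩
  · obtain ⟨a, ha, hle⟩ := (hat.eq_bot_or_exists_atom_le _).resolve_left
      (CylAlg.Fr.offDiag_ne_bot hK)
    exact CylAlg.Fr.not_isAtom_of_le_offDiag hK hn hle ha
  · have := CylAlg.Fr.offDiag_ne_bot hK (m := m)
    rw [CylAlg.Fr.offDiag_eq_mk] at this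
    refine fun h => this (le_bot_iff.1 ((?_ : _ ≤ _).trans (CylAlg.Fr.proves_iff.1 h)))
    exact (CylAlg.Fr.le_mk_conj _ _).2 fun s hs => by
      rw [Finset.mem_singleton.1 (Finset.mem_toList.1 hs)]
  · refine CylAlg.Fr.not_isAtom_of_le_offDiag hK hn ?_ (CylAlg.Fr.isAtom_of_complete hT hc)
    rw [CylAlg.Fr.offDiag_eq_mk]
    exact CylAlg.Fr.proves_iff.1 hp
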